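/- Conventions. A relational system $R=\langle X,Y,\sqsubset\rangle$ consists of two non-empty sets $X,Y$ and a relation $\sqsubset$. A set $F\subseteq X$ is $R$-bounded if some $y\in Y$ satisfies $x\sqsubset y$ for all $x\in F$, and $E\subseteq Y$ is $R$-dominating if for every $x\in X$ there is $y\in E$ with $x\sqsubset y$. Let $\mathfrak b(R)$ be the least size of a subset of $X$ that is not $R$-bounded, and $\mathfrak d(R)$ the least size of an $R$-dominating subset of $Y$ (each is $\infty$ if there is no such set). For $R'=\langle X',Y',\sqsubset'\rangle$ write $R\preceq_{\mathrm T}R'$ if there are $f\colon X\to X'$ and $g\colon Y'\to Y$ such that $f(x)\sqsubset' y'$ implies $x\sqsubset g(y')$ for all $x\in X$, $y'\in Y'$. A partial order $S$ is identified with $\langle S,S,\leq\rangle$, products of partial orders are ordered coordinatewise, and $K\cap N:=\langle A\cap N,B\cap N,\lhd\rangle$ for $K=\langle A,B,\lhd\rangle$ and a set $N$. Fix a regular cardinal $\chi$; $H_\chi$ is the set of all sets whose transitive closure has size less than $\chi$. A set $N$ is ${<}\kappa$-closed if every function from an ordinal less than $\kappa$ into $N$ belongs to $N$. Let $\kappa,\theta$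 be infinite cardinals, $\kappa$ uncountable regular, and $T$ a non-empty directed partial order without maximum. A sequence $\langle N_t: t\in T\rangle$ of elementary submodels of $H_\chi$ is a $(T,\kappa,\theta)$-directed system if for all $t,t'\in T$: (1) $N_t$ is ${<}\kappa$-closed and $|N_t|=\theta$; (2) $t\leq t'$ implies $N_t\subseteq N_{t'}$; (3) $\theta\cup\{\theta,T\}\subseteq N_t$. Here a partial order $T$, as an element of a model, is the set together with its order. Lemma. Let $\bar N^0=\langle N^0_t: t\in T\rangle$ be a $(T,\kappa^0,\theta^0)$-directed system and $\bar N^1=\langle N^1_\alpha:\alpha<\lambda\rangle$ a $(\lambda,\kappa^1,\theta^1)$-directed system, where $\lambda$ is a limit ordinal, and let $N^0=\bigcup_{t\in T}N^0_t$ and $N^1=\bigcup_{\alpha<\lambda}N^1_\alpha$. Assume: (i) $\bar N^0\in N^1_0$ (the sequence taken together with the partial order $T$ that indexes it) and $\theta^1<\kappa^0$; (ii) $N^1_\alpha\in N^1$ for all $\alpha<\lambda$; (iii) $T\subseteq N^1_0$. Then $\kappa^1\leq\theta^1<\kappa^0\leq\theta^0$ and $|T|\leq\theta^1$. Let $\Lambda:=T\times\lambda$,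 $N_{(t,\alpha)}:=N^0_t\cap N^1_\alpha$ for $(t,\alpha)\in\Lambda$, and $N:=\bigcup_{\eta\in\Lambda}N_\eta$. (a) $N=N^0\cap N^1$, and $\langle N_\eta:\eta\in\Lambda\rangle$ satisfies all requirements on a $(\Lambda,\kappa^1,\theta^1)$-directed system except possibly $\Lambda\in N_\eta$. If moreover $\lambda\in N^0_t$ for all $t\in T$, then it is a $(\Lambda,\kappa^1,\theta^1)$-directed system. (b) If $K=\langle A,B,\lhd\rangle$ is a relational system with $K\in N^0\cap N^1_0$ and $\mathfrak b(K)>\theta^1$, then $K\cap N$ is a relational system and $K\cap N\preceq_{\mathrm T}\Lambda$. In particular, $\min\{\mathfrak b(T),\mathrm{cf}(\lambda)\}\leq\mathfrak b(K\cap N)$ and $\mathfrak d(K\cap N)\leq\max\{\mathfrak d(T),\mathrm{cf}(\lambda)\}$. -/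

import Mathlib

open Cardinal FirstOrder

universe u

/-! ### The language of set theory and elementary submodels of `H χ`

Throughout, the universe of sets is `ZFSet.{u}`. -/

/-- The relation symbols of the language of set theory: one binary symbol. -/
inductive MemRel : ℕ → Type
  | mem : MemRel 2

/-- The first-order language of set theory `{∈}`. -/
def setLang : Language := ⟨fun _ => Empty, MemRel⟩

/-- Every collection of sets is an `{∈}`-structure, the symbol being read as real membership. -/
instance memStructure (s : Set ZFSet.{u}) : setLang.Structure s where
  funMap := fun f _ => f.elim
  RelMap := fun r => match r with
    | MemRel.mem => fun v => (v 0 : ZFSet.{u}) ∈ (v 1 : ZFSet.{u})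

/-- `H χ`: the sets whose transitive closure has cardinality `< χ`. -/
def Hset (χ : Cardinal.{u}) : Set ZFSet.{u} :=
  {x | ∃ t : ZFSet.{u}, t.IsTransitive ∧ x ⊆ t ∧ t.card < χ}

/-- `M ≼ H χ`: `M` is the underlying set of an elementary substructure of `(H χ, ∈)`. -/
def IsElemSubmodel (χ : Cardinal.{u}) (M : ZFSet.{u}) : Prop :=
  ∃ S : setLang.ElementarySubstructure (Hset χ),
    Subtype.val '' (S : Set (Hset χ)) = {x : ZFSet.{u} | x ∈ M}

/-- `M` is `<κ`-closed: every function from an ordinal `< κ` into `M` is an element of `M`. -/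
def IsLtClosed (κ : Cardinal.{u}) (M : ZFSet.{u}) : Prop :=
  ∀ α : Ordinal.{u}, α < κ.ord → ∀ f : ZFSet.{u}, ZFSet.IsFunc α.toZFSet M f → f ∈ M

/-! ### Relational systems, the numbers `𝔟` and `𝔡`, and the Tukey order -/

/-- The data of a relational system `⟨X, Y, ⊏⟩`; the relation is a set of ordered pairs. -/
structure RelSys where
  X : ZFSet.{u}
  Y : ZFSet.{u}
  r : ZFSet.{u}

namespace RelSys

/-- The relational system as a set: the triple `⟨X, Y, ⊏⟩`. -/
def code (R : RelSys.{u}) : ZFSet.{u} := ZFSet.pair R.X (ZFSet.pair R.Y R.r)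

/-- `x ⊏ y`. -/
def Rel (R : RelSys.{u}) (x y : ZFSet.{u}) : Prop := ZFSet.pair x y ∈ R.r

/-- Both base sets of a relational system have to be non-empty. -/
def IsProper (R : RelSys.{u}) : Prop := R.X.Nonempty ∧ R.Y.Nonempty

def Bounded (R : RelSys.{u}) (F : ZFSet.{u}) : Prop := ∃ y ∈ R.Y, ∀ x ∈ F, R.Rel x y

def Dominating (R : RelSys.{u}) (E : ZFSet.{u}) : Prop := ∀ x ∈ R.X, ∃ y ∈ E, R.Rel x y

/-- The unbounding number: the least cardinality of an unbounded subset of `X`, and `⊤` (that is,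
`∞`) if there is no unbounded subset. -/
noncomputable def bnum (R : RelSys.{u}) : WithTop Cardinal.{u} :=
  sInf {c | ∃ F : ZFSet.{u}, F ⊆ R.X ∧ ¬ R.Bounded F ∧ c = (F.card : WithTop Cardinal.{u})}

/-- The dominating number: the least cardinality of a dominating subset of `Y`, and `⊤` (that is,
`∞`) if there is no dominating subset. -/
noncomputable def dnum (R : RelSys.{u}) : WithTop Cardinal.{u} :=
  sInf {c | ∃ E : ZFSet.{u}, E ⊆ R.Y ∧ R.Dominating E ∧ c = (E.card : WithTop Cardinal.{u})}

/-- `R ≼_T R'`: there is a Tukey connection from `R` into `R'`. -/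
def TukeyLE (R R' : RelSys.{u}) : Prop :=
  ∃ f g : ZFSet.{u} → ZFSet.{u},
    (∀ x ∈ R.X, f x ∈ R'.X) ∧ (∀ y' ∈ R'.Y, g y' ∈ R.Y) ∧
      ∀ x ∈ R.X, ∀ y' ∈ R'.Y, R'.Rel (f x) y' → R.Rel x (g y')

/-- `K ∩ N = ⟨A ∩ N, B ∩ N, ◁⟩` for `K = ⟨A, B, ◁⟩`. -/
def restrict (K : RelSys.{u}) (N : ZFSet.{u}) : RelSys.{u} := ⟨K.X ∩ N, K.Y ∩ N, K.r⟩

end RelSys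

/-! ### Ordered sets -/

/-- The coordinates of an ordered pair. -/
noncomputable def pairFst (z : ZFSet.{u}) : ZFSet.{u} :=
  Classical.epsilon fun x => ∃ y, z = ZFSet.pair x y

noncomputable def pairSnd (z : ZFSet.{u}) : ZFSet.{u} :=
  Classical.epsilon fun y => ∃ x, z = ZFSet.pair x y

theorem pairFst_pair (x y : ZFSet.{u}) : pairFst (ZFSet.pair x y) = x := by
  have h : ∃ x' y', ZFSet.pair x y = ZFSet.pair x' y' := ⟨x, y, rfl⟩
  obtain ⟨y', hy'⟩ := Classical.epsilon_spec h
  exact (ZFSet.pair_inj.1 hy').1.symm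

theorem pairSnd_pair (x y : ZFSet.{u}) : pairSnd (ZFSet.pair x y) = y := by
  have h : ∃ y' x', ZFSet.pair x y = ZFSet.pair x' y' := ⟨y, x, rfl⟩
  obtain ⟨x', hx'⟩ := Classical.epsilon_spec h
  exact (ZFSet.pair_inj.1 hx').2.symm

/-- The data of an ordered set `⟨S, ≤⟩`; the order is a set of ordered pairs. -/
structure OrdSys where
  carrier : ZFSet.{u}
  le : ZFSet.{u}

namespace OrdSys

/-- The ordered set as a set: the pair `⟨S, ≤⟩`. -/
def code (T : OrdSys.{u}) : ZFSet.{u} := ZFSet.pair T.carrier T.le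

/-- `s ≤ t`. -/
def Le (T : OrdSys.{u}) (s t : ZFSet.{u}) : Prop := ZFSet.pair s t ∈ T.le

/-- An ordered set seen as the relational system `⟨S, S, ≤⟩`. -/
def toRelSys (T : OrdSys.{u}) : RelSys.{u} := ⟨T.carrier, T.carrier, T.le⟩

/-- `T` is a non-empty directed partial order without maximum. -/
structure IsDirectedNoMax (T : OrdSys.{u}) : Prop where
  nonempty : T.carrier.Nonempty
  le_subset : T.le ⊆ ZFSet.prod T.carrier T.carrier
  refl : ∀ s ∈ T.carrier, T.Le s s
  trans : ∀ s t v, T.Le s t → T.Le t v → T.Le s v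
  antisymm : ∀ s t, T.Le s t → T.Le t s → s = t
  directed : ∀ s ∈ T.carrier, ∀ t ∈ T.carrier, ∃ v ∈ T.carrier, T.Le s v ∧ T.Le t v
  no_max : ¬ ∃ m ∈ T.carrier, ∀ s ∈ T.carrier, T.Le s m

/-- An ordinal with its usual order (on von Neumann ordinals, `≤` is inclusion). -/
noncomputable def ofOrdinal (o : Ordinal.{u}) : OrdSys.{u} :=
  ⟨o.toZFSet, ZFSet.pairSep (fun a b => a ⊆ b) o.toZFSet o.toZFSet⟩

/-- The product `T × L` with the coordinatewise order. -/
noncomputable def prod (T L : OrdSys.{u}) : OrdSys.{u} :=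
  ⟨ZFSet.prod T.carrier L.carrier,
    ZFSet.pairSep (fun p q => T.Le (pairFst p) (pairFst q) ∧ L.Le (pairSnd p) (pairSnd q))
      (ZFSet.prod T.carrier L.carrier) (ZFSet.prod T.carrier L.carrier)⟩

end OrdSys

/-! ### Systems of models

A sequence indexed by (the underlying set of) `T` is given by a map `N`, of which only the values
`N t` with `t ∈ T` matter. -/

/-- The sequence `⟨N t : t ∈ T⟩` as a set, together with the ordered set `T` that indexes it. -/
noncomputable def seqCode (T : OrdSys.{u}) (N : ZFSet.{u} → ZFSet.{u}) : ZFSet.{u} :=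
  ZFSet.pair T.code (ZFSet.range fun t : T.carrier => ZFSet.pair (t : ZFSet.{u}) (N t))

/-- `⋃ N t`, the union over all `t ∈ T`. -/
noncomputable def seqUnion (T : OrdSys.{u}) (N : ZFSet.{u} → ZFSet.{u}) : ZFSet.{u} :=
  ZFSet.iUnion fun t : T.carrier => N t

/-- The family `η ↦ N⁰_{η(0)} ∩ N¹_{η(1)}`. -/
noncomputable def interSeq (N0 N1 : ZFSet.{u} → ZFSet.{u}) (η : ZFSet.{u}) : ZFSet.{u} :=
  N0 (pairFst η) ∩ N1 (pairSnd η)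

/-- All requirements on a `(T, κ, θ)`-directed system of elementary submodels of `H χ`, except for
`T ∈ N t`. -/
structure IsModelFamily (χ : Cardinal.{u}) (T : OrdSys.{u}) (κ θ : Cardinal.{u})
    (N : ZFSet.{u} → ZFSet.{u}) : Prop where
  regular : κ.IsRegular
  uncountable : ℵ₀ < κ
  infinite : ℵ₀ ≤ θ
  index : T.IsDirectedNoMax
  elem : ∀ t ∈ T.carrier, IsElemSubmodel χ (N t)
  closed : ∀ t ∈ T.carrier, IsLtClosed κ (N t)
  card_eq : ∀ t ∈ T.carrier, (N t).card = θ
  mono : ∀ s ∈ T.carrier, ∀ t ∈ T.carrier, T.Le s t → N s ⊆ N t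
  theta_subset : ∀ t ∈ T.carrier, θ.ord.toZFSet ⊆ N t
  theta_mem : ∀ t ∈ T.carrier, θ.ord.toZFSet ∈ N t

/-- `⟨N t : t ∈ T⟩` is a `(T, κ, θ)`-directed system of elementary submodels of `H χ`. -/
structure IsDirectedSystem (χ : Cardinal.{u}) (T : OrdSys.{u}) (κ θ : Cardinal.{u})
    (N : ZFSet.{u} → ZFSet.{u}) : Prop extends IsModelFamily χ T κ θ N where
  index_mem : ∀ t ∈ T.carrier, T.code ∈ N t

/-! ### Definability over `H χ` with parameters from a model -/

section Definability

variable {χ : Cardinal.{u}} {M : ZFSet.{u}} {α β : Type}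

/-! The main tool is `IsElemSubmodel.inter`: if `M0` and `M1` are elementary in `H χ` and `M0 ∈ M1`,
then `M0 ∩ M1` is elementary in `H χ`. It applies to every pair `N0 t`, `N1 α`, because the first
model `N1 ∅` contains the sequence `N0` and each index `t`, hence each value `N0 t`, and the `N1 α`
increase. The remaining requirements in (a) are inherited: closure because `κ1 ≤ θ1 < κ0`, and size
exactly `θ1` because `θ1 ⊆ N0 t ∩ N1 α` and `N1 α` has size `θ1`. The inequality `κ ≤ θ` holds in
every system, since a model smaller than its degree of closure would be an element of itself.

For (b) it suffices to bound the trace of `K.X` on each `N_η` by a point of `N`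
(`restrict_tukeyLE`). Such a trace `F` has size at most `θ1`, so `𝔟(K) > θ1` bounds it by some point
of `K.Y`. To find a bound in `N`, note that `F` lies in a suitable `N0 s` by closure, as `θ1 < κ0`,
and in some `N1 β` because `N1 α ∈ N1 β` for some `β`. Hence `F` and `K` both belong to the
elementary submodel `N0 s ∩ N1 β`, which must contain a bound (`exists_bound_inter`). The
inequalities for `𝔟` and `𝔡` then follow from monotonicity under Tukey connections and the estimates
for products and ordinals.

Elementarity is used through `Dfn`, definability with parameters from a model: a true existential
statement of this kind has a witness in the model. -/

theorem mem_Hset_of_mem {x y : ZFSet.{u}} (hx : x ∈ Hset χ) (hy : y ∈ x) : y ∈ Hset χ := by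
  obtain ⟨t, ht, hxt, hc⟩ := hx
  exact ⟨t, ht, ht y (hxt hy), hc⟩

theorem mem_Hset_of_subset {x y : ZFSet.{u}} (hx : x ∈ Hset χ) (hy : y ⊆ x) : y ∈ Hset χ := by
  obtain ⟨t, ht, hxt, hc⟩ := hx
  exact ⟨t, ht, fun z hz => hxt (hy hz), hc⟩

/-- The membership symbol. -/
def memSymbol : setLang.Relations 2 := MemRel.mem

/-- `P` is definable in `H χ` by a first-order formula with parameters from `M`. -/
def Dfn (χ : Cardinal.{u}) (M : ZFSet.{u}) (P : (α → Hset χ) → Prop) : Prop :=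
  ∃ φ : setLang.Formula ({c : Hset χ // (c : ZFSet.{u}) ∈ M} ⊕ α),
    ∀ v, φ.Realize (Sum.elim (fun c => c.1) v) ↔ P v

/-- A variable or a parameter from `M`. -/
inductive IsTerm (χ : Cardinal.{u}) (M : ZFSet.{u}) : ((α → Hset χ) → ZFSet.{u}) → Prop
  | var (i : α) : IsTerm χ M fun v => v i
  | const (c : ZFSet.{u}) (hc : c ∈ Hset χ) (hM : c ∈ M) : IsTerm χ M fun _ => c

theorem IsTerm.comp {s : (α → Hset χ) → ZFSet.{u}} (hs : IsTerm χ M s) (g : α → β) :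
    IsTerm χ M fun w : β → Hset χ => s fun i => w (g i) := by
  cases hs with
  | var i => exact .var (g i)
  | const c hc hM => exact .const c hc hM

theorem IsTerm.exists_index {s : (α → Hset χ) → ZFSet.{u}} (hs : IsTerm χ M s) :
    ∃ i : {c : Hset χ // (c : ZFSet.{u}) ∈ M} ⊕ α,
      ∀ v, (Sum.elim (fun c => c.1) v i : Hset χ) = s v := by
  cases hs with
  | var i => exact ⟨.inr i, fun v => rfl⟩
  | const c hc hM => exact ⟨.inl ⟨⟨c, hc⟩, hM⟩, fun v => rfl⟩

theorem IsTerm.mem_Hset {s : (α → Hset χ) → ZFSet.{u}} (hs : IsTerm χ M s) (v : α → Hset χ) :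
    s v ∈ Hset χ := by
  obtain ⟨i, hi⟩ := hs.exists_index
  rw [← hi v]
  exact Subtype.prop _

namespace Dfn

variable {P Q : (α → Hset χ) → Prop} {s t r : (α → Hset χ) → ZFSet.{u}}

theorem congr (h : Dfn χ M P) (hPQ : ∀ v, Q v ↔ P v) : Dfn χ M Q := by
  obtain ⟨φ, hφ⟩ := h
  exact ⟨φ, fun v => (hφ v).trans (hPQ v).symm⟩

theorem mem (hs : IsTerm χ M s) (ht : IsTerm χ M t) : Dfn χ M fun v => s v ∈ t v := by
  obtain ⟨i, hi⟩ := hs.exists_index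
  obtain ⟨j, hj⟩ := ht.exists_index
  refine ⟨memSymbol.formula₂ (.var i) (.var j), fun v => ?_⟩
  beta_reduce
  rw [← hi v, ← hj v, Language.Formula.realize_rel₂]
  rfl

theorem eq (hs : IsTerm χ M s) (ht : IsTerm χ M t) : Dfn χ M fun v => s v = t v := by
  obtain ⟨i, hi⟩ := hs.exists_index
  obtain ⟨j, hj⟩ := ht.exists_index
  refine ⟨Language.Term.equal (.var i) (.var j), fun v => ?_⟩
  beta_reduce
  rw [← hi v, ← hj v, Language.Formula.realize_equal]
  exact Subtype.ext_iff

theorem not (h : Dfn χ M P) : Dfn χ M fun v => ¬ P v := by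
  obtain ⟨φ, hφ⟩ := h
  exact ⟨φ.not, fun v => by rw [Language.Formula.realize_not, hφ]⟩

theorem imp (h : Dfn χ M P) (h' : Dfn χ M Q) : Dfn χ M fun v => P v → Q v := by
  obtain ⟨φ, hφ⟩ := h
  obtain ⟨ψ, hψ⟩ := h'
  exact ⟨φ.imp ψ, fun v => by rw [Language.Formula.realize_imp, hφ, hψ]⟩

theorem and (h : Dfn χ M P) (h' : Dfn χ M Q) : Dfn χ M fun v => P v ∧ Q v :=
  (h.imp h'.not).not.congr fun v => by tauto

theorem or (h : Dfn χ M P) (h' : Dfn χ M Q) : Dfn χ M fun v => P v ∨ Q v :=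
  (h.not.imp h').congr fun v => by tauto

theorem iff (h : Dfn χ M P) (h' : Dfn χ M Q) : Dfn χ M fun v => (P v ↔ Q v) :=
  ((h.imp h').and (h'.imp h)).congr fun v => by tauto

theorem ex {R : (α → Hset χ) → Hset χ → Prop}
    (h : Dfn χ M fun w : α ⊕ Unit → Hset χ => R (fun i => w (.inl i)) (w (.inr ()))) :
    Dfn χ M fun v => ∃ x, R v x := by
  obtain ⟨φ, hφ⟩ := h
  refine ⟨Language.Formula.iExs Unit (φ.relabel (Equiv.sumAssoc _ _ _).symm), fun v => ?_⟩
  rw [Language.Formula.realize_iExs]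
  have key (i : Unit → Hset χ) : (φ.relabel (Equiv.sumAssoc _ _ _).symm).Realize
      (Sum.elim (Sum.elim (fun c => c.1) v) i) ↔ R v (i ()) := by
    rw [Language.Formula.realize_relabel]
    refine Iff.trans (iff_of_eq ?_) (hφ (Sum.elim v i))
    refine congrArg _ (funext ?_)
    rintro (c | c | c) <;> rfl
  constructor
  · rintro ⟨i, hi⟩
    exact ⟨_, (key i).1 hi⟩
  · rintro ⟨x, hx⟩
    exact ⟨fun _ => x, (key _).2 hx⟩

theorem all {R : (α → Hset χ) → Hset χ → Prop}
    (h : Dfn χ M fun w : α ⊕ Unit → Hset χ => R (fun i => w (.inl i)) (w (.inr ()))) :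
    Dfn χ M fun v => ∀ x, R v x :=
  (ex (R := fun v x => ¬ R v x) h.not).not.congr fun v => by push Not; rfl

/-- Variables may be renamed and replaced by parameters. -/
theorem inst (h : Dfn χ M P) (g : α → {c : Hset χ // (c : ZFSet.{u}) ∈ M} ⊕ β) :
    Dfn χ M fun w : β → Hset χ => P fun i => Sum.elim (fun c => c.1) w (g i) := by
  obtain ⟨φ, hφ⟩ := h
  refine ⟨φ.relabel (Sum.elim .inl g), fun v => ?_⟩
  rw [Language.Formula.realize_relabel]
  refine Iff.trans (iff_of_eq (congrArg _ (funext ?_))) (hφ _)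
  rintro (c | c) <;> rfl

theorem comp (h : Dfn χ M P) (g : α → β) : Dfn χ M fun w : β → Hset χ => P fun i => w (g i) :=
  h.inst fun i => .inr (g i)

theorem false : Dfn χ M fun _ : α → Hset χ => False :=
  ⟨⊥, fun _ => Language.Formula.realize_bot⟩

/-- Since `H χ` is transitive, a quantifier over the members of a set of `H χ` has the same meaning
there as in the universe. This is why set-theoretic notions can be read as real ones here and below.
-/
theorem eq_singleton (hs : IsTerm χ M s) (ht : IsTerm χ M t) :
    Dfn χ M fun v => s v = {t v} := by
  refine ((mem ht hs).and (all (R := fun v x => (x : ZFSet.{u}) ∈ s v → (x : ZFSet.{u}) = t v)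
    ((mem (.var _) (hs.comp _)).imp (eq (.var _) (ht.comp _))))).congr fun v => ?_
  constructor
  · intro h
    simp [h]
  · rintro ⟨h, h'⟩
    ext z
    rw [ZFSet.mem_singleton]
    exact ⟨fun hz => h' ⟨z, mem_Hset_of_mem (hs.mem_Hset v) hz⟩ hz, fun hz => hz ▸ h⟩

theorem eq_upair (hs : IsTerm χ M s) (ht : IsTerm χ M t) (hr : IsTerm χ M r) :
    Dfn χ M fun v => s v = {t v, r v} := by
  refine (((mem ht hs).and (mem hr hs)).and (all (R := fun v x => (x : ZFSet.{u}) ∈ s v →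
    (x : ZFSet.{u}) = t v ∨ (x : ZFSet.{u}) = r v)
    ((mem (.var _) (hs.comp _)).imp
      ((eq (.var _) (ht.comp _)).or (eq (.var _) (hr.comp _)))))).congr fun v => ?_
  constructor
  · intro h
    simp [h]
  · rintro ⟨⟨h, h''⟩, h'⟩
    ext z
    rw [ZFSet.mem_pair]
    exact ⟨fun hz => h' ⟨z, mem_Hset_of_mem (hs.mem_Hset v) hz⟩ hz, by rintro (rfl | rfl) <;> assumption⟩

theorem eq_pair (hs : IsTerm χ M s) (ht : IsTerm χ M t) (hr : IsTerm χ M r) :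
    Dfn χ M fun v => s v = ZFSet.pair (t v) (r v) := by
  refine (ex (R := fun v x => (x : ZFSet.{u}) = {t v} ∧ ∃ y : Hset χ, (y : ZFSet.{u}) = {t v, r v} ∧
    s v = {(x : ZFSet.{u}), (y : ZFSet.{u})}) ((eq_singleton (.var _) (ht.comp _)).and
    (ex ((eq_upair (.var _) ((ht.comp _).comp _) ((hr.comp _).comp _)).and
      (eq_upair ((hs.comp _).comp _) (.var _) (.var _)))))).congr fun v => ?_
  constructor
  · intro h
    have h1 : ({t v} : ZFSet.{u}) ∈ s v := by simp [h, ZFSet.pair]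
    have h2 : ({t v, r v} : ZFSet.{u}) ∈ s v := by simp [h, ZFSet.pair]
    -- The singleton and the unordered pair are members of `s v`, so they lie in `H χ` by
    -- transitivity; regularity of `χ` is not needed.
    exact ⟨⟨_, mem_Hset_of_mem (hs.mem_Hset v) h1⟩, rfl, ⟨_, mem_Hset_of_mem (hs.mem_Hset v) h2⟩, rfl, h⟩
  · rintro ⟨x, hx, y, hy, h⟩
    rw [h, hx, hy]
    rfl

theorem pair_mem (hs : IsTerm χ M s) (ht : IsTerm χ M t) (hr : IsTerm χ M r) :
    Dfn χ M fun v => ZFSet.pair (s v) (t v) ∈ r v := by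
  refine (ex (R := fun v p => (p : ZFSet.{u}) = ZFSet.pair (s v) (t v) ∧ (p : ZFSet.{u}) ∈ r v)
    ((eq_pair (.var _) (hs.comp _) (ht.comp _)).and (mem (.var _) (hr.comp _)))).congr fun v => ?_
  constructor
  · intro h
    exact ⟨⟨_, mem_Hset_of_mem (hr.mem_Hset v) h⟩, rfl, h⟩
  · rintro ⟨p, hp, h⟩
    rwa [← hp]

end Dfn

/-! ### Elementary submodels -/

namespace IsElemSubmodel

theorem mem_Hset (hM : IsElemSubmodel χ M) {x : ZFSet.{u}} (hx : x ∈ M) : x ∈ Hset χ := by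
  obtain ⟨S, hS⟩ := hM
  obtain ⟨y, -, rfl⟩ : x ∈ Subtype.val '' (S : Set (Hset χ)) := hS ▸ hx
  exact y.2

/-- This is one direction of the Tarski–Vaught criterion: the existential formula passes from `H χ`
down to the submodel, and the witness found there satisfies the matrix in `H χ` again. -/
theorem exists_mem_Hset (hM : IsElemSubmodel χ M) {P : Hset χ → Prop}
    (hP : Dfn χ M fun v : Unit → Hset χ => P (v ())) (h : ∃ x, P x) :
    ∃ x : Hset χ, (x : ZFSet.{u}) ∈ M ∧ P x := by
  obtain ⟨S, hS⟩ := hM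
  have hmem (x : Hset χ) : x ∈ S ↔ (x : ZFSet.{u}) ∈ M := by
    have : (x : ZFSet.{u}) ∈ Subtype.val '' (S : Set (Hset χ)) ↔ (x : ZFSet.{u}) ∈ M := by
      rw [hS]; rfl
    simpa using this
  obtain ⟨φ, hφ⟩ := hP
  obtain ⟨x, hPx⟩ := h
  let c : {c : Hset χ // (c : ZFSet.{u}) ∈ M} → S := fun c => ⟨c.1, (hmem _).2 c.2⟩
  have h1 : (φ.iExs Unit).Realize (S.subtype ∘ c) :=
    Language.Formula.realize_iExs.2 ⟨fun _ => x, (hφ fun _ => x).2 hPx⟩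
  rw [S.subtype.map_formula, Language.Formula.realize_iExs] at h1
  obtain ⟨i, hi⟩ := h1
  rw [← S.subtype.map_formula] at hi
  refine ⟨(i ()).1, (hmem _).1 (i ()).2, (hφ fun _ => (i ()).1).1 ?_⟩
  convert hi using 1
  funext j
  rcases j with j | j <;> rfl

theorem exists_mem (hM : IsElemSubmodel χ M) {P : ZFSet.{u} → Prop}
    (hP : Dfn χ M fun v : Unit → Hset χ => P (v ())) (h : ∃ x ∈ Hset χ, P x) : ∃ x ∈ M, P x := by
  obtain ⟨x, hx, hPx⟩ := h
  obtain ⟨y, hy, hPy⟩ := hM.exists_mem_Hset (P := fun x => P x) hP ⟨⟨x, hx⟩, hPx⟩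
  exact ⟨y, hy, hPy⟩

/-- An element of `H χ` whose members are definable from parameters in `M` belongs to `M`. -/
theorem mem_of_definable (hM : IsElemSubmodel χ M) {z : ZFSet.{u}} {Q : ZFSet.{u} → Prop} (hz : z ∈ Hset χ)
    (hQ : Dfn χ M fun v : Unit → Hset χ => Q (v ()))
    (h : ∀ y ∈ Hset χ, y ∈ z ↔ Q y) : z ∈ M := by
  obtain ⟨z', hz', hQz'⟩ := hM.exists_mem
    (P := fun z' => ∀ y : Hset χ, (y : ZFSet.{u}) ∈ z' ↔ Q y)
    (Dfn.all (Dfn.iff (Dfn.mem (.var _) (.var _)) (hQ.comp fun _ => Sum.inr ())))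
    ⟨z, hz, fun y => h y y.2⟩
  suffices z = z' by rwa [this]
  ext y
  constructor
  · intro hy
    exact (hQz' ⟨y, mem_Hset_of_mem hz hy⟩).2 ((h y (mem_Hset_of_mem hz hy)).1 hy)
  · intro hy
    have hyH := mem_Hset_of_mem (hM.mem_Hset hz') hy
    exact (h y hyH).2 ((hQz' ⟨y, hyH⟩).1 hy)

theorem const (hM : IsElemSubmodel χ M) {c : ZFSet.{u}} (hc : c ∈ M) : IsTerm χ M fun _ : α → Hset χ => c :=
  .const c (hM.mem_Hset hc) hc

end IsElemSubmodel

end Definability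

/-! ### Intersections of elementary submodels -/

section Intersection

variable {χ : Cardinal.{u}} {M M0 M1 : ZFSet.{u}}

theorem setLang_term_eq_var {α : Type} (t : setLang.Term α) : ∃ i, t = .var i := by
  cases t with
  | var i => exact ⟨i, rfl⟩
  | func f _ => exact f.elim

/-- Satisfaction in a submodel `M0 ∈ M` is definable over `H χ` with parameters from `M`. -/
theorem exists_dfn_realize {S : setLang.ElementarySubstructure (Hset χ)}
    (hS : ∀ x : Hset χ, x ∈ S ↔ (x : ZFSet.{u}) ∈ M0) (hH : M0 ∈ Hset χ) (h : M0 ∈ M) {n : ℕ}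
    (φ : setLang.BoundedFormula Empty n) :
    ∃ R : (Fin n → Hset χ) → Prop, Dfn χ M R ∧
      ∀ w : Fin n → S, R (fun i => w i) ↔ φ.Realize default w := by
  induction φ with
  | falsum => exact ⟨_, Dfn.false, fun w => Iff.rfl⟩
  | equal t₁ t₂ =>
    obtain ⟨i | i, rfl⟩ := setLang_term_eq_var t₁
    · exact i.elim
    obtain ⟨j | j, rfl⟩ := setLang_term_eq_var t₂
    · exact j.elim
    refine ⟨_, Dfn.eq (.var i) (.var j), fun w => ?_⟩
    exact (Subtype.ext_iff.symm.trans Subtype.ext_iff.symm)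
  | @rel n l r ts =>
    rcases r with _ | _
    obtain ⟨i | i, hi⟩ := setLang_term_eq_var (ts 0)
    · exact i.elim
    obtain ⟨j | j, hj⟩ := setLang_term_eq_var (ts 1)
    · exact j.elim
    refine ⟨_, Dfn.mem (.var i) (.var j), fun w => ?_⟩
    have key : ((w i : Hset χ) : ZFSet.{u}) ∈ ((w j : Hset χ) : ZFSet.{u}) ↔
        (((ts 0).realize (Sum.elim default w) : S) : Hset χ).1 ∈
        (((ts 1).realize (Sum.elim default w) : S) : Hset χ).1 := by
      rw [hi, hj]
      rfl
    exact key
  | imp φ ψ hφ hψ =>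
    obtain ⟨R, hR, hR'⟩ := hφ
    obtain ⟨R₂, hR₂, hR₂'⟩ := hψ
    exact ⟨_, hR.imp hR₂, fun w => imp_congr (hR' w) (hR₂' w)⟩
  | @all n φ hφ =>
    obtain ⟨R, hR, hR'⟩ := hφ
    -- Satisfaction in `M0` is obtained by relativising each quantifier to the parameter `M0`; the
    -- other connectives are unchanged.
    refine ⟨_, Dfn.all (R := fun v x => (x : ZFSet.{u}) ∈ M0 → R (Fin.snoc v x))
      ((Dfn.mem (.var _) (.const M0 hH h)).imp ((hR.comp
        (Fin.lastCases (.inr ()) .inl : Fin (n + 1) → Fin n ⊕ Unit)).congr fun w => ?_)),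
      fun w => ?_⟩
    · refine iff_of_eq (congrArg R (funext fun i => ?_))
      induction i using Fin.lastCases <;> simp
    · have (x : S) : (fun i => ((Fin.snoc w x : Fin (n + 1) → S) i : Hset χ)) =
          Fin.snoc (fun i => (w i : Hset χ)) (x : Hset χ) := by
        funext i
        induction i using Fin.lastCases <;> simp
      rw [Language.BoundedFormula.realize_all]
      constructor
      · intro H x
        rw [← hR', this]
        exact H x ((hS x).1 x.2)
      · intro H x hx
        have h' := H ⟨x, (hS x).2 hx⟩
        rwa [← hR', this] at h'

/-- By Tarski–Vaught. If an existential formula with parameters in the intersection holds in `H χ`,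
it has a witness in `M0`. That some member of `M0` satisfies the matrix inside `M0` is expressible
over `H χ` with parameters from `M1`, one of them `M0`. So `M1` contains such a member, and
elementarity of `M0` makes it a witness in `H χ`. -/
theorem IsElemSubmodel.inter (h0 : IsElemSubmodel χ M0) (h1 : IsElemSubmodel χ M1)
    (h : M0 ∈ M1) : IsElemSubmodel χ (M0 ∩ M1) := by
  obtain ⟨S, hS⟩ := h0
  have hmem (x : Hset χ) : x ∈ S ↔ (x : ZFSet.{u}) ∈ M0 := by
    have : (x : ZFSet.{u}) ∈ Subtype.val '' (S : Set (Hset χ)) ↔ (x : ZFSet.{u}) ∈ M0 := by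
      rw [hS]; rfl
    simpa using this
  let I : setLang.Substructure (Hset χ) := ⟨{x | (x : ZFSet.{u}) ∈ M0 ∩ M1}, fun f => f.elim⟩
  have hI (x : I) : (x : Hset χ).1 ∈ M0 ∧ (x : Hset χ).1 ∈ M1 := ZFSet.mem_inter.1 x.2
  refine ⟨I.toElementarySubstructure fun n φ x a hφ => ?_, ?_⟩
  · obtain ⟨R, hR, hR'⟩ := exists_dfn_realize hmem (h1.mem_Hset h) h φ
    let x0 : Fin n → S := fun i => ⟨x i, (hmem _).2 (hI (x i)).1⟩
    have hsnoc (b : S) : (fun i => ((Fin.snoc x0 b : Fin (n + 1) → S) i : Hset χ)) =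
        Fin.snoc ((↑) ∘ x) (b : Hset χ) := by
      funext i
      induction i using Fin.lastCases <;> simp [x0]
    have hex : φ.ex.Realize (S.subtype ∘ default) (S.subtype ∘ x0) := by
      rw [Language.BoundedFormula.realize_ex]
      refine ⟨a, ?_⟩
      rw [Subsingleton.elim (_ ∘ default) (default : Empty → Hset χ)]
      exact hφ
    rw [S.subtype.map_boundedFormula, Language.BoundedFormula.realize_ex] at hex
    obtain ⟨a0, ha0⟩ := hex
    have hdfn : Dfn χ M1 fun v : Unit → Hset χ => ((v () : Hset χ) : ZFSet.{u}) ∈ M0 ∧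
        R (Fin.snoc ((↑) ∘ x) (v ())) := by
      refine (Dfn.mem (.var _) (.const M0 (h1.mem_Hset h) h)).and ((hR.inst
        (Fin.lastCases (.inr ()) (fun i => .inl ⟨x i, (hI (x i)).2⟩) :
          Fin (n + 1) → {c : Hset χ // (c : ZFSet.{u}) ∈ M1} ⊕ Unit)).congr fun w => ?_)
      refine iff_of_eq (congrArg R (funext fun i => ?_))
      induction i using Fin.lastCases <;> simp
    obtain ⟨b, hb1, hb0, hb⟩ := h1.exists_mem_Hset
      (P := fun z => (z : ZFSet.{u}) ∈ M0 ∧ R (Fin.snoc ((↑) ∘ x) z)) hdfn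
      ⟨a0, (hmem _).1 a0.2, by
        rw [← hsnoc, hR']
        exact ha0⟩
    refine ⟨⟨b, ZFSet.mem_inter.2 ⟨hb0, hb1⟩⟩, ?_⟩
    have hb' : R (fun i => ((Fin.snoc x0 ⟨b, (hmem b).2 hb0⟩ : Fin (n + 1) → S) i : Hset χ)) := by
      rw [hsnoc]; exact hb
    rw [hR', ← S.subtype.map_boundedFormula] at hb'
    have e : S.subtype ∘ (Fin.snoc x0 ⟨b, (hmem b).2 hb0⟩ : Fin (n + 1) → S) = _ := hsnoc _
    rw [e] at hb'
    convert hb'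
  · ext x
    constructor
    · rintro ⟨y, hy, rfl⟩
      exact hy
    · intro hx
      exact ⟨⟨x, h1.mem_Hset (ZFSet.mem_inter.1 hx).2⟩, hx, rfl⟩

end Intersection

/-! ### Closure properties of `H χ` and of its elementary submodels -/

section Closure

variable {χ κ : Cardinal.{u}} {M : ZFSet.{u}}

theorem card_iUnion_lt {χ : Cardinal.{u}} (hχ : χ.IsRegular) {ι : Type u} (hι : #ι < χ)
    (f : ι → ZFSet.{u}) (hf : ∀ i, (f i).card < χ) : (ZFSet.iUnion f).card < χ := by
  refine lt_of_le_of_lt ?_ (sum_lt_of_isRegular hχ hι hf)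
  simpa using ZFSet.lift_card_iUnion_le_sum_card (f := f)

/-- The set together with the union of transitive sets covering its members is transitive, and
regularity of `χ` keeps it smaller than `χ`. -/
theorem mem_Hset_of_card_lt (hχ : χ.IsRegular) {z : ZFSet.{u}} (hz : ∀ y ∈ z, y ∈ Hset χ)
    (hc : z.card < χ) : z ∈ Hset χ := by
  have (y : Shrink.{u} z) : ∃ t : ZFSet.{u}, t.IsTransitive ∧
      ((equivShrink z).symm y : ZFSet.{u}) ⊆ t ∧ t.card < χ := hz _ ((equivShrink z).symm y).2
  choose t ht hyt htc using this
  refine ⟨z ∪ ZFSet.iUnion t, fun y hy w hw => ?_, fun w hw => ZFSet.mem_union.2 (.inl hw), ?_⟩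
  · rw [ZFSet.mem_union, ZFSet.mem_iUnion]
    right
    rcases ZFSet.mem_union.1 hy with hy | hy
    · refine ⟨equivShrink z ⟨y, hy⟩, hyt _ ?_⟩
      simpa using hw
    · obtain ⟨i, hi⟩ := ZFSet.mem_iUnion.1 hy
      exact ⟨i, ht i y hi hw⟩
  · exact ZFSet.card_union_le.trans_lt
      (add_lt_of_lt hχ.aleph0_le hc (card_iUnion_lt hχ hc t htc))

theorem upair_mem_Hset (hχ : χ.IsRegular) {x y : ZFSet.{u}} (hx : x ∈ Hset χ) (hy : y ∈ Hset χ) :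
    ({x, y} : ZFSet.{u}) ∈ Hset χ := by
  refine mem_Hset_of_card_lt hχ (fun z hz => ?_) ?_
  · rcases ZFSet.mem_pair.1 hz with rfl | rfl <;> assumption
  · refine (ZFSet.card_insert_le.trans_lt ?_).trans_le hχ.aleph0_le
    rw [ZFSet.card_singleton]
    exact add_lt_aleph0 one_lt_aleph0 one_lt_aleph0

theorem pair_mem_Hset (hχ : χ.IsRegular) {x y : ZFSet.{u}} (hx : x ∈ Hset χ) (hy : y ∈ Hset χ) :
    ZFSet.pair x y ∈ Hset χ := by
  refine upair_mem_Hset hχ ?_ (upair_mem_Hset hχ hx hy)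
  rw [← ZFSet.pair_eq_singleton]
  exact upair_mem_Hset hχ hx hx

theorem pair_components_mem_Hset {x y z : ZFSet.{u}} (hz : z ∈ Hset χ)
    (h : ZFSet.pair x y ∈ z) : x ∈ Hset χ ∧ y ∈ Hset χ := by
  have h1 : ({x, y} : ZFSet.{u}) ∈ Hset χ :=
    mem_Hset_of_mem (mem_Hset_of_mem hz h) (ZFSet.mem_pair.2 (.inr rfl))
  exact ⟨mem_Hset_of_mem h1 (by simp), mem_Hset_of_mem h1 (by simp)⟩

theorem card_lt_of_mem_Hset {x : ZFSet.{u}} (hx : x ∈ Hset χ) : x.card < χ := by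
  obtain ⟨t, -, hxt, hc⟩ := hx
  exact (ZFSet.card_mono hxt).trans_lt hc

theorem card_prod_le (x y : ZFSet.{u}) : (ZFSet.prod x y).card ≤ x.card * y.card := by
  have h : ZFSet.prod x y = ZFSet.range fun p : Shrink.{u} x × Shrink.{u} y =>
      ZFSet.pair ((equivShrink x).symm p.1) ((equivShrink y).symm p.2) := by
    ext z
    rw [ZFSet.mem_prod, ZFSet.mem_range]
    constructor
    · rintro ⟨a, ha, b, hb, rfl⟩
      exact ⟨(equivShrink x ⟨a, ha⟩, equivShrink y ⟨b, hb⟩), by simp⟩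
    · rintro ⟨p, rfl⟩
      exact ⟨_, Subtype.prop _, _, Subtype.prop _, rfl⟩
  have := ZFSet.lift_card_range_le (f := fun p : Shrink.{u} x × Shrink.{u} y =>
      ZFSet.pair ((equivShrink x).symm p.1) ((equivShrink y).symm p.2))
  rw [← h, mk_prod] at this
  simpa [ZFSet.card] using this

theorem pairSep_mem_Hset (hχ : χ.IsRegular) {x y : ZFSet.{u}} (p : ZFSet.{u} → ZFSet.{u} → Prop)
    (hx : x ∈ Hset χ) (hy : y ∈ Hset χ) : ZFSet.pairSep p x y ∈ Hset χ := by
  refine mem_Hset_of_card_lt hχ (fun z hz => ?_) ?_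
  · obtain ⟨a, ha, b, hb, rfl, -⟩ := ZFSet.mem_pairSep.1 hz
    exact pair_mem_Hset hχ (mem_Hset_of_mem hx ha) (mem_Hset_of_mem hy hb)
  · refine lt_of_le_of_lt (ZFSet.card_mono (y := ZFSet.prod x y) fun z hz => ?_)
      ((card_prod_le x y).trans_lt (mul_lt_of_lt hχ.aleph0_le (card_lt_of_mem_Hset hx)
        (card_lt_of_mem_Hset hy)))
    obtain ⟨a, ha, b, hb, rfl, -⟩ := ZFSet.mem_pairSep.1 hz
    exact ZFSet.pair_mem_prod.2 ⟨ha, hb⟩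

namespace IsElemSubmodel

variable {x y z f : ZFSet.{u}}

theorem of_pair_mem (hM : IsElemSubmodel χ M) (h : ZFSet.pair x y ∈ M) : x ∈ M ∧ y ∈ M := by
  have hp := hM.mem_Hset h
  have h1 : ({x, y} : ZFSet.{u}) ∈ Hset χ := mem_Hset_of_mem hp (ZFSet.mem_pair.2 (.inr rfl))
  have hx : x ∈ Hset χ := mem_Hset_of_mem h1 (by simp)
  have hy : y ∈ Hset χ := mem_Hset_of_mem h1 (by simp)
  constructor
  · obtain ⟨a, ha, b, hab⟩ := hM.exists_mem
      (P := fun a => ∃ b : Hset χ, ZFSet.pair x y = ZFSet.pair a b)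
      (Dfn.ex (Dfn.eq_pair (hM.const h) (.var _) (.var _))) ⟨x, hx, ⟨y, hy⟩, rfl⟩
    rwa [(ZFSet.pair_inj.1 hab).1]
  · obtain ⟨b, hb, a, hab⟩ := hM.exists_mem
      (P := fun b => ∃ a : Hset χ, ZFSet.pair x y = ZFSet.pair a b)
      (Dfn.ex (Dfn.eq_pair (hM.const h) (.var _) (.var _))) ⟨y, hy, ⟨x, hx⟩, rfl⟩
    rwa [(ZFSet.pair_inj.1 hab).2]

theorem pair_mem (hM : IsElemSubmodel χ M) (hχ : χ.IsRegular) (hx : x ∈ M) (hy : y ∈ M) :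
    ZFSet.pair x y ∈ M := by
  obtain ⟨p, hp, rfl⟩ := hM.exists_mem (P := fun p => p = ZFSet.pair x y)
    (Dfn.eq_pair (.var _) (hM.const hx) (hM.const hy))
    ⟨_, pair_mem_Hset hχ (hM.mem_Hset hx) (hM.mem_Hset hy), rfl⟩
  exact hp

/-- A model containing a function and an argument contains the value. -/
theorem value_mem (hM : IsElemSubmodel χ M) (hf : f ∈ M) (hx : x ∈ M)
    (h : ZFSet.pair x y ∈ f) (hu : ∀ z, ZFSet.pair x z ∈ f → z = y) : y ∈ M := by
  obtain ⟨z, hz, hxz⟩ := hM.exists_mem (P := fun z => ZFSet.pair x z ∈ f)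
    (Dfn.pair_mem (hM.const hx) (.var _) (hM.const hf))
    ⟨y, (pair_components_mem_Hset (hM.mem_Hset hf) h).2, h⟩
  rwa [← hu z hxz]

theorem inter_mem (hM : IsElemSubmodel χ M) (hx : x ∈ M) (hy : y ∈ M) : x ∩ y ∈ M :=
  hM.mem_of_definable (Q := fun z => z ∈ x ∧ z ∈ y)
    (mem_Hset_of_subset (hM.mem_Hset hx) fun _ hz => (ZFSet.mem_inter.1 hz).1)
    ((Dfn.mem (.var _) (hM.const hx)).and (Dfn.mem (.var _) (hM.const hy)))
    fun _ _ => ZFSet.mem_inter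

theorem exists_mem_of_nonempty (hM : IsElemSubmodel χ M) (hx : x ∈ M) (h : x.Nonempty) :
    ∃ y ∈ M, y ∈ x := by
  obtain ⟨y, hy⟩ := h
  exact hM.exists_mem (P := fun y => y ∈ x) (Dfn.mem (.var _) (hM.const hx))
    ⟨y, mem_Hset_of_mem (hM.mem_Hset hx) hy, hy⟩

/-- An enumeration of `F` by the initial ordinal of its cardinality is in `M` by closure, and `F` is
definable from it as its range. -/
theorem mem_of_subset_of_card_lt (hM : IsElemSubmodel χ M) (hcl : IsLtClosed κ M)
    {F : ZFSet.{u}} (hF : F ⊆ M) (hc : F.card < κ) : F ∈ M := by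
  have e : Nonempty (Set.Iio F.card.ord ≃ F) := by
    refine Cardinal.eq.1 ?_
    rw [mk_Iio_ordinal, ZFSet.cardinalMk_coe_sort, card_ord]
  obtain ⟨e⟩ := e
  let f : ZFSet.{u} := ZFSet.range fun a : Set.Iio F.card.ord => ZFSet.pair a.1.toZFSet (e a)
  have hf : ZFSet.IsFunc F.card.ord.toZFSet M f := by
    constructor
    · intro z hz
      obtain ⟨a, rfl⟩ := ZFSet.mem_range.1 hz
      exact ZFSet.pair_mem_prod.2 ⟨Ordinal.toZFSet_mem_toZFSet_iff.2 a.2, hF (e a).2⟩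
    · intro z hz
      obtain ⟨a, ha, rfl⟩ := Ordinal.mem_toZFSet_iff.1 hz
      refine ⟨e ⟨a, ha⟩, ZFSet.mem_range.2 ⟨⟨a, ha⟩, rfl⟩, fun w hw => ?_⟩
      obtain ⟨b, hb⟩ := ZFSet.mem_range.1 hw
      obtain ⟨h1, rfl⟩ := ZFSet.pair_inj.1 hb
      have : b = ⟨a, ha⟩ := Subtype.ext (Ordinal.toZFSet_injective h1)
      rw [this]
  have hfM := hcl _ (ord_lt_ord.2 hc) f hf
  have hfH := hM.mem_Hset hfM
  have hmem (y : ZFSet.{u}) (hy : y ∈ F) : ∃ x, ZFSet.pair x y ∈ f :=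
    ⟨_, ZFSet.mem_range.2 ⟨e.symm ⟨y, hy⟩, by rw [e.apply_symm_apply]⟩⟩
  refine hM.mem_of_definable (Q := fun y => ∃ x : Hset χ, ZFSet.pair x y ∈ f) ?_
    (Dfn.ex (Dfn.pair_mem (.var _) (.var _) (hM.const hfM))) fun y _ => ?_
  -- The transitive set witnessing that the enumeration is in `H χ` also covers `F`.
  · obtain ⟨t, ht, hft, htc⟩ := hfH
    refine ⟨t, ht, fun y hy => ?_, htc⟩
    obtain ⟨x, hx⟩ := hmem y hy
    have h1 : ({x, y} : ZFSet.{u}) ∈ t := ht _ (hft hx) (ZFSet.mem_pair.2 (.inr rfl))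
    exact ht _ h1 (by simp)
  · constructor
    · intro hy
      obtain ⟨x, hx⟩ := hmem y hy
      exact ⟨⟨x, (pair_components_mem_Hset hfH hx).1⟩, hx⟩
    · rintro ⟨x, hx⟩
      obtain ⟨a, ha⟩ := ZFSet.mem_range.1 hx
      rw [← (ZFSet.pair_inj.1 ha).2]
      exact (e a).2

/-- Otherwise `M`, as a small subset of itself, would be a member of itself. -/
theorem le_card_of_isLtClosed (hM : IsElemSubmodel χ M) (hcl : IsLtClosed κ M) : κ ≤ M.card := by
  by_contra! h
  exact ZFSet.mem_irrefl M (hM.mem_of_subset_of_card_lt hcl (fun _ h => h) h)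

theorem pairSep_subset_mem (hM : IsElemSubmodel χ M) (hχ : χ.IsRegular) (hx : x ∈ M) :
    ZFSet.pairSep (fun a b => a ⊆ b) x x ∈ M := by
  have hxH := hM.mem_Hset hx
  refine hM.mem_of_definable (Q := fun y => ∃ a : Hset χ, (a : ZFSet.{u}) ∈ x ∧ ∃ b : Hset χ,
    (b : ZFSet.{u}) ∈ x ∧ y = ZFSet.pair a b ∧ ∀ c : Hset χ, (c : ZFSet.{u}) ∈ (a : ZFSet.{u}) →
      (c : ZFSet.{u}) ∈ (b : ZFSet.{u}))
    (pairSep_mem_Hset hχ _ hxH hxH)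
    (.ex (.and (.mem (.var _) (hM.const hx)) (.ex (.and (.mem (.var _) (hM.const hx))
      (.and (.eq_pair (.var _) (.var _) (.var _))
        (.all (.imp (.mem (.var _) (.var _)) (.mem (.var _) (.var _)))))))))
    fun y _ => ?_
  rw [ZFSet.mem_pairSep]
  constructor
  · rintro ⟨a, ha, b, hb, rfl, hab⟩
    exact ⟨⟨a, mem_Hset_of_mem hxH ha⟩, ha, ⟨b, mem_Hset_of_mem hxH hb⟩, hb, rfl,
      fun c hc => hab hc⟩
  · rintro ⟨a, ha, b, hb, rfl, hab⟩
    exact ⟨a, ha, b, hb, rfl, fun c hc => hab ⟨c, mem_Hset_of_mem a.2 hc⟩ hc⟩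

theorem prod_mem (hM : IsElemSubmodel χ M) (hχ : χ.IsRegular) (hx : x ∈ M) (hy : y ∈ M) :
    ZFSet.prod x y ∈ M := by
  have hxH := hM.mem_Hset hx
  have hyH := hM.mem_Hset hy
  refine hM.mem_of_definable (Q := fun z => ∃ a : Hset χ, (a : ZFSet.{u}) ∈ x ∧ ∃ b : Hset χ,
    (b : ZFSet.{u}) ∈ y ∧ z = ZFSet.pair a b)
    (pairSep_mem_Hset hχ _ hxH hyH)
    (.ex (.and (.mem (.var _) (hM.const hx)) (.ex (.and (.mem (.var _) (hM.const hy))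
      (.eq_pair (.var _) (.var _) (.var _)))))) fun z _ => ?_
  rw [ZFSet.mem_prod]
  constructor
  · rintro ⟨a, ha, b, hb, rfl⟩
    exact ⟨⟨a, mem_Hset_of_mem hxH ha⟩, ha, ⟨b, mem_Hset_of_mem hyH hb⟩, hb, rfl⟩
  · rintro ⟨a, ha, b, hb, rfl⟩
    exact ⟨a, ha, b, hb, rfl⟩

theorem code_ofOrdinal_mem (hM : IsElemSubmodel χ M) (hχ : χ.IsRegular) {o : Ordinal.{u}}
    (ho : o.toZFSet ∈ M) : (OrdSys.ofOrdinal o).code ∈ M :=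
  hM.pair_mem hχ ho (hM.pairSep_subset_mem hχ ho)

theorem code_prod_mem (hM : IsElemSubmodel χ M) (hχ : χ.IsRegular) {T L : OrdSys.{u}}
    (hT : T.code ∈ M) (hL : L.code ∈ M) : (T.prod L).code ∈ M := by
  obtain ⟨hT, hT'⟩ := hM.of_pair_mem hT
  obtain ⟨hL, hL'⟩ := hM.of_pair_mem hL
  have hP := hM.prod_mem hχ hT hL
  have hPH := hM.mem_Hset hP
  refine hM.pair_mem hχ hP ?_
  refine hM.mem_of_definable (Q := fun z => ∃ p : Hset χ, (p : ZFSet.{u}) ∈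
      ZFSet.prod T.carrier L.carrier ∧ ∃ q : Hset χ, (q : ZFSet.{u}) ∈
      ZFSet.prod T.carrier L.carrier ∧ z = ZFSet.pair p q ∧ ∃ a b c d : Hset χ,
      (p : ZFSet.{u}) = ZFSet.pair a b ∧ (q : ZFSet.{u}) = ZFSet.pair c d ∧
      ZFSet.pair a c ∈ T.le ∧ ZFSet.pair b d ∈ L.le)
    (pairSep_mem_Hset hχ _ hPH hPH)
    (.ex (.and (.mem (.var _) (hM.const hP)) (.ex (.and (.mem (.var _) (hM.const hP))
      (.and (.eq_pair (.var _) (.var _) (.var _)) (.ex (.ex (.ex (.ex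
        (.and (.eq_pair (.var _) (.var _) (.var _)) (.and (.eq_pair (.var _) (.var _) (.var _))
          (.and (.pair_mem (.var _) (.var _) (hM.const hT'))
            (.pair_mem (.var _) (.var _) (hM.const hL'))))))))))))))
    fun z _ => ?_
  refine ZFSet.mem_pairSep.trans ?_
  constructor
  · rintro ⟨p, hp, q, hq, rfl, h1, h2⟩
    obtain ⟨a, ha, b, hb, rfl⟩ := ZFSet.mem_prod.1 hp
    obtain ⟨c, hc, d, hd, rfl⟩ := ZFSet.mem_prod.1 hq
    rw [pairFst_pair, pairFst_pair] at h1
    rw [pairSnd_pair, pairSnd_pair] at h2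
    have hTH := hM.mem_Hset hT
    have hLH := hM.mem_Hset hL
    exact ⟨⟨_, mem_Hset_of_mem hPH hp⟩, hp, ⟨_, mem_Hset_of_mem hPH hq⟩, hq, rfl,
      ⟨a, mem_Hset_of_mem hTH ha⟩, ⟨b, mem_Hset_of_mem hLH hb⟩, ⟨c, mem_Hset_of_mem hTH hc⟩,
      ⟨d, mem_Hset_of_mem hLH hd⟩, rfl, rfl, h1, h2⟩
  · rintro ⟨p, hp, q, hq, rfl, a, b, c, d, h1, h2, h3, h4⟩
    refine ⟨p, hp, q, hq, rfl, ?_⟩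
    rw [h1, h2, pairFst_pair, pairFst_pair, pairSnd_pair, pairSnd_pair]
    exact ⟨h3, h4⟩

end IsElemSubmodel

end Closure

/-! ### Tukey connections, products and ordinals -/

section Orders

theorem exists_image (f : ZFSet.{u} → ZFSet.{u}) (x : ZFSet.{u}) :
    ∃ y : ZFSet.{u}, (∀ z, z ∈ y ↔ ∃ a ∈ x, f a = z) ∧ y.card ≤ x.card := by
  let := Classical.allZFSetDefinable fun v : Fin 1 → ZFSet.{u} => f (v 0)
  have : ZFSet.Definable₁ f := this
  exact ⟨ZFSet.image f x, fun z => ZFSet.mem_image, ZFSet.card_image_le⟩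

namespace RelSys

variable {R R' : RelSys.{u}}

theorem bounded_of_card_lt {F : ZFSet.{u}} (hF : F ⊆ R.X)
    (h : (F.card : WithTop Cardinal.{u}) < R.bnum) : R.Bounded F := by
  by_contra hb
  have hle : R.bnum ≤ (F.card : WithTop Cardinal.{u}) := sInf_le ⟨F, hF, hb, rfl⟩
  exact not_le_of_gt h hle

theorem le_bnum {c : WithTop Cardinal.{u}}
    (h : ∀ F : ZFSet.{u}, F ⊆ R.X → (F.card : WithTop Cardinal.{u}) < c → R.Bounded F) :
    c ≤ R.bnum := by
  refine le_sInf ?_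
  rintro _ ⟨F, hF, hb, rfl⟩
  by_contra! hc
  exact hb (h F hF hc)

theorem dnum_le {E : ZFSet.{u}} (hE : E ⊆ R.Y) (hd : R.Dominating E) :
    R.dnum ≤ (E.card : WithTop Cardinal.{u}) :=
  sInf_le ⟨E, hE, hd, rfl⟩

theorem exists_card_eq_dnum (h : R.dnum ≠ ⊤) :
    ∃ E : ZFSet.{u}, E ⊆ R.Y ∧ R.Dominating E ∧ R.dnum = (E.card : WithTop Cardinal.{u}) := by
  refine csInf_mem (s := {c | ∃ E : ZFSet.{u}, E ⊆ R.Y ∧ R.Dominating E ∧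
    c = (E.card : WithTop Cardinal.{u})}) ?_
  by_contra hne
  refine h ?_
  rw [dnum, Set.not_nonempty_iff_eq_empty.1 hne, WithTop.sInf_empty]

theorem TukeyLE.bnum_le (h : R.TukeyLE R') : R'.bnum ≤ R.bnum := by
  obtain ⟨f, g, hf, hg, hfg⟩ := h
  refine le_bnum fun F hF hc => ?_
  obtain ⟨F', hF', hcF⟩ := exists_image f F
  obtain ⟨y, hy, hyF⟩ : R'.Bounded F' := by
    refine bounded_of_card_lt (fun z hz => ?_) ((WithTop.coe_le_coe.2 hcF).trans_lt hc)
    obtain ⟨a, ha, rfl⟩ := (hF' z).1 hz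
    exact hf a (hF ha)
  exact ⟨g y, hg y hy, fun x hx => hfg x (hF hx) y hy (hyF _ ((hF' _).2 ⟨x, hx, rfl⟩))⟩

theorem TukeyLE.dnum_le (h : R.TukeyLE R') : R.dnum ≤ R'.dnum := by
  obtain ⟨f, g, hf, hg, hfg⟩ := h
  by_cases htop : R'.dnum = ⊤
  · rw [htop]
    exact le_top
  obtain ⟨E, hE, hd, hc⟩ := exists_card_eq_dnum htop
  obtain ⟨E', hE', hcE⟩ := exists_image g E
  rw [hc]
  refine (RelSys.dnum_le (E := E') (fun z hz => ?_) fun x hx => ?_).trans (WithTop.coe_le_coe.2 hcE)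
  · obtain ⟨a, ha, rfl⟩ := (hE' z).1 hz
    exact hg a (hE ha)
  · obtain ⟨y, hy, hxy⟩ := hd (f x) (hf x hx)
    exact ⟨g y, (hE' _).2 ⟨y, hy, rfl⟩, hfg x hx y (hE hy) hxy⟩

end RelSys

namespace OrdSys

variable {T L : OrdSys.{u}}

theorem mem_carrier_prod {p : ZFSet.{u}} :
    p ∈ (T.prod L).carrier ↔ ∃ a ∈ T.carrier, ∃ b ∈ L.carrier, p = ZFSet.pair a b :=
  ZFSet.mem_prod

theorem pair_mem_carrier_prod {a b : ZFSet.{u}} :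
    ZFSet.pair a b ∈ (T.prod L).carrier ↔ a ∈ T.carrier ∧ b ∈ L.carrier :=
  ZFSet.pair_mem_prod

theorem prod_le_iff {p q : ZFSet.{u}} : (T.prod L).Le p q ↔
    p ∈ (T.prod L).carrier ∧ q ∈ (T.prod L).carrier ∧
      T.Le (pairFst p) (pairFst q) ∧ L.Le (pairSnd p) (pairSnd q) := by
  refine ZFSet.mem_pairSep.trans ⟨?_, ?_⟩
  · rintro ⟨a, ha, b, hb, h, h'⟩
    obtain ⟨rfl, rfl⟩ := ZFSet.pair_inj.1 h
    exact ⟨ha, hb, h'⟩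
  · rintro ⟨ha, hb, h⟩
    exact ⟨p, ha, q, hb, rfl, h⟩

theorem prod_le_pair {a b c d : ZFSet.{u}} (ha : a ∈ T.carrier) (hb : b ∈ L.carrier)
    (hc : c ∈ T.carrier) (hd : d ∈ L.carrier) :
    (T.prod L).Le (ZFSet.pair a b) (ZFSet.pair c d) ↔ T.Le a c ∧ L.Le b d := by
  rw [prod_le_iff, pairFst_pair, pairFst_pair, pairSnd_pair, pairSnd_pair, pair_mem_carrier_prod,
    pair_mem_carrier_prod]
  tauto

theorem IsDirectedNoMax.prod (hT : T.IsDirectedNoMax) (hL : L.IsDirectedNoMax) :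
    (T.prod L).IsDirectedNoMax where
  nonempty := by
    obtain ⟨a, ha⟩ := hT.nonempty
    obtain ⟨b, hb⟩ := hL.nonempty
    exact ⟨_, pair_mem_carrier_prod.2 ⟨ha, hb⟩⟩
  le_subset := fun z hz => by
    obtain ⟨p, hp, q, hq, rfl, -⟩ := ZFSet.mem_pairSep.1 hz
    exact ZFSet.pair_mem_prod.2 ⟨hp, hq⟩
  refl := fun s hs => by
    obtain ⟨a, ha, b, hb, rfl⟩ := mem_carrier_prod.1 hs
    exact (prod_le_pair ha hb ha hb).2 ⟨hT.refl a ha, hL.refl b hb⟩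
  trans := fun s t v h1 h2 => by
    rw [prod_le_iff] at *
    exact ⟨h1.1, h2.2.1, hT.trans _ _ _ h1.2.2.1 h2.2.2.1, hL.trans _ _ _ h1.2.2.2 h2.2.2.2⟩
  antisymm := fun s t h1 h2 => by
    obtain ⟨a, ha, b, hb, rfl⟩ := mem_carrier_prod.1 (prod_le_iff.1 h1).1
    obtain ⟨c, hc, d, hd, rfl⟩ := mem_carrier_prod.1 (prod_le_iff.1 h1).2.1
    rw [prod_le_pair ha hb hc hd] at h1
    rw [prod_le_pair hc hd ha hb] at h2
    rw [hT.antisymm _ _ h1.1 h2.1, hL.antisymm _ _ h1.2 h2.2]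
  directed := fun s hs t ht => by
    obtain ⟨a, ha, b, hb, rfl⟩ := mem_carrier_prod.1 hs
    obtain ⟨c, hc, d, hd, rfl⟩ := mem_carrier_prod.1 ht
    obtain ⟨v, hv, hav, hcv⟩ := hT.directed a ha c hc
    obtain ⟨w, hw, hbw, hdw⟩ := hL.directed b hb d hd
    exact ⟨_, pair_mem_carrier_prod.2 ⟨hv, hw⟩, (prod_le_pair ha hb hv hw).2 ⟨hav, hbw⟩,
      (prod_le_pair hc hd hv hw).2 ⟨hcv, hdw⟩⟩
  no_max := by
    rintro ⟨m, hm, hmax⟩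
    obtain ⟨a, ha, b, hb, rfl⟩ := mem_carrier_prod.1 hm
    exact hT.no_max ⟨a, ha, fun s hs =>
      ((prod_le_pair hs hb ha hb).1 (hmax _ (pair_mem_carrier_prod.2 ⟨hs, hb⟩))).1⟩

theorem min_bnum_le_bnum_prod :
    min T.toRelSys.bnum L.toRelSys.bnum ≤ (T.prod L).toRelSys.bnum := by
  refine RelSys.le_bnum fun F hF hc => ?_
  obtain ⟨F₁, hF₁, hc₁⟩ := exists_image pairFst F
  obtain ⟨F₂, hF₂, hc₂⟩ := exists_image pairSnd F
  obtain ⟨t, ht, htF⟩ : T.toRelSys.Bounded F₁ := by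
    refine RelSys.bounded_of_card_lt (fun z hz => ?_)
      ((WithTop.coe_le_coe.2 hc₁).trans_lt (hc.trans_le (min_le_left _ _)))
    obtain ⟨p, hp, rfl⟩ := (hF₁ z).1 hz
    obtain ⟨a, ha, b, hb, rfl⟩ := mem_carrier_prod.1 (hF hp)
    rwa [pairFst_pair]
  obtain ⟨l, hl, hlF⟩ : L.toRelSys.Bounded F₂ := by
    refine RelSys.bounded_of_card_lt (fun z hz => ?_)
      ((WithTop.coe_le_coe.2 hc₂).trans_lt (hc.trans_le (min_le_right _ _)))
    obtain ⟨p, hp, rfl⟩ := (hF₂ z).1 hz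
    obtain ⟨a, ha, b, hb, rfl⟩ := mem_carrier_prod.1 (hF hp)
    rwa [pairSnd_pair]
  have hmem : ZFSet.pair t l ∈ (T.prod L).carrier := pair_mem_carrier_prod.2 ⟨ht, hl⟩
  refine ⟨ZFSet.pair t l, hmem, fun p hp => prod_le_iff.2 ⟨hF hp, hmem, ?_, ?_⟩⟩
  · rw [pairFst_pair]
    exact htF _ ((hF₁ _).2 ⟨p, hp, rfl⟩)
  · rw [pairSnd_pair]
    exact hlF _ ((hF₂ _).2 ⟨p, hp, rfl⟩)

/-- A product of dominating sets dominates. Since `c` is infinite, the product of the cardinals is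
at most their maximum, even when the other factor is finite. -/
theorem dnum_prod_le {c : Cardinal.{u}} (hc : ℵ₀ ≤ c)
    (hL : L.toRelSys.dnum ≤ (c : WithTop Cardinal.{u})) :
    (T.prod L).toRelSys.dnum ≤ max T.toRelSys.dnum (c : WithTop Cardinal.{u}) := by
  by_cases htop : T.toRelSys.dnum = ⊤
  · rw [htop, max_eq_left le_top]
    exact le_top
  obtain ⟨D, hD, hDd, hDc⟩ := RelSys.exists_card_eq_dnum htop
  obtain ⟨E, hE, hEd, hEc⟩ := RelSys.exists_card_eq_dnum (ne_top_of_le_ne_top WithTop.coe_ne_top hL)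
  rw [hEc, WithTop.coe_le_coe] at hL
  rw [hDc]
  refine (RelSys.dnum_le (E := ZFSet.prod D E) (fun z hz => ?_) fun p hp => ?_).trans
    ((WithTop.coe_le_coe.2 (((card_prod_le D E).trans (mul_le_mul_right hL _)).trans
      (mul_le_max_of_aleph0_le_right hc))).trans_eq (WithTop.coe_max _ _))
  · obtain ⟨a, ha, b, hb, rfl⟩ := ZFSet.mem_prod.1 hz
    exact pair_mem_carrier_prod.2 ⟨hD ha, hE hb⟩
  · obtain ⟨a, ha, b, hb, rfl⟩ := mem_carrier_prod.1 hp
    obtain ⟨a', ha', haa'⟩ := hDd a ha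
    obtain ⟨b', hb', hbb'⟩ := hEd b hb
    exact ⟨_, ZFSet.pair_mem_prod.2 ⟨ha', hb'⟩, (prod_le_pair ha hb (hD ha') (hE hb')).2 ⟨haa', hbb'⟩⟩

variable {o : Ordinal.{u}}

theorem ofOrdinal_le_iff {a b : ZFSet.{u}} :
    (ofOrdinal o).Le a b ↔ a ∈ o.toZFSet ∧ b ∈ o.toZFSet ∧ a ⊆ b := by
  rw [Le, ofOrdinal, ZFSet.mem_pairSep]
  refine ⟨?_, ?_⟩
  · rintro ⟨a, ha, b, hb, h, h'⟩
    obtain ⟨rfl, rfl⟩ := ZFSet.pair_inj.1 h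
    exact ⟨ha, hb, h'⟩
  · rintro ⟨ha, hb, h⟩
    exact ⟨a, ha, b, hb, rfl, h⟩

theorem cof_le_bnum_ofOrdinal :
    (o.cof : WithTop Cardinal.{u}) ≤ (ofOrdinal o).toRelSys.bnum := by
  refine RelSys.le_bnum fun F hF hc => ?_
  have hc' : #(Shrink.{u} F) < o.cof := WithTop.coe_lt_coe.1 hc
  -- The rank recovers an ordinal from its von Neumann set; the supremum of the ranks stays below
  -- `o` by the definition of cofinality and bounds `F`.
  let f : Shrink.{u} F → Ordinal.{u} := fun i => ((equivShrink F).symm i : ZFSet.{u}).rank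
  have hrank {x : ZFSet.{u}} (hx : x ∈ F) : x.rank < o ∧ x.rank.toZFSet = x := by
    obtain ⟨a, ha, rfl⟩ := Ordinal.mem_toZFSet_iff.1 (hF hx)
    rw [Ordinal.rank_toZFSet]
    exact ⟨ha, rfl⟩
  have hsup := Ordinal.iSup_lt_of_lt_cof (f := f) hc' fun i => (hrank (Subtype.prop _)).1
  have hmem := Ordinal.toZFSet_mem_toZFSet_iff.2 hsup
  refine ⟨_, hmem, fun x hx => ofOrdinal_le_iff.2 ⟨hF hx, hmem, ?_⟩⟩
  rw [← (hrank hx).2, Ordinal.toZFSet_subset_toZFSet_iff]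
  have := Ordinal.le_iSup f (equivShrink F ⟨x, hx⟩)
  simpa [f] using this

theorem dnum_ofOrdinal_le :
    (ofOrdinal o).toRelSys.dnum ≤ (o.cof : WithTop Cardinal.{u}) := by
  obtain ⟨s, hs, hc⟩ := Order.exists_cof_eq o.ToType
  rw [Ordinal.cof_toType] at hc
  have hcard := ZFSet.lift_card_range_le (f := fun x : s => (Ordinal.ToType.mk.symm x.1).1.toZFSet)
  rw [lift_id, lift_id, hc] at hcard
  refine (RelSys.dnum_le (fun z hz => ?_) fun x hx => ?_).trans (WithTop.coe_le_coe.2 hcard)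
  · obtain ⟨i, rfl⟩ := ZFSet.mem_range.1 hz
    exact Ordinal.toZFSet_mem_toZFSet_iff.2 (Ordinal.ToType.mk.symm i.1).2
  · obtain ⟨a, ha, rfl⟩ := Ordinal.mem_toZFSet_iff.1 hx
    obtain ⟨b, hb, hab⟩ := hs (Ordinal.ToType.mk ⟨a, ha⟩)
    refine ⟨_, ZFSet.mem_range.2 ⟨⟨b, hb⟩, rfl⟩, ofOrdinal_le_iff.2 ⟨hx,
      Ordinal.toZFSet_mem_toZFSet_iff.2 (Ordinal.ToType.mk.symm b).2, ?_⟩⟩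
    rw [Ordinal.toZFSet_subset_toZFSet_iff]
    exact (OrderIso.le_symm_apply Ordinal.ToType.mk).2 hab

end OrdSys

end Orders

theorem mem_seqUnion {T : OrdSys.{u}} {N : ZFSet.{u} → ZFSet.{u}} {x : ZFSet.{u}} :
    x ∈ seqUnion T N ↔ ∃ t ∈ T.carrier, x ∈ N t :=
  ZFSet.mem_iUnion.trans ⟨fun ⟨t, h⟩ => ⟨t, t.2, h⟩, fun ⟨t, ht, h⟩ => ⟨⟨t, ht⟩, h⟩⟩

theorem interSeq_pair (N0 N1 : ZFSet.{u} → ZFSet.{u}) (t a : ZFSet.{u}) :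
    interSeq N0 N1 (ZFSet.pair t a) = N0 t ∩ N1 a := by
  rw [interSeq, pairFst_pair, pairSnd_pair]

theorem seqUnion_interSeq (T L : OrdSys.{u}) (N0 N1 : ZFSet.{u} → ZFSet.{u}) :
    seqUnion (T.prod L) (interSeq N0 N1) = seqUnion T N0 ∩ seqUnion L N1 := by
  ext x
  rw [ZFSet.mem_inter, mem_seqUnion, mem_seqUnion, mem_seqUnion]
  constructor
  · rintro ⟨p, hp, hx⟩
    obtain ⟨t, ht, a, ha, rfl⟩ := OrdSys.mem_carrier_prod.1 hp
    rw [interSeq_pair, ZFSet.mem_inter] at hx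
    exact ⟨⟨t, ht, hx.1⟩, a, ha, hx.2⟩
  · rintro ⟨⟨t, ht, hx⟩, a, ha, hx'⟩
    refine ⟨_, OrdSys.pair_mem_carrier_prod.2 ⟨ht, ha⟩, ?_⟩
    rw [interSeq_pair, ZFSet.mem_inter]
    exact ⟨hx, hx'⟩

theorem IsLtClosed.mono {κ κ' : Cardinal.{u}} (h : κ ≤ κ') {M : ZFSet.{u}}
    (hM : IsLtClosed κ' M) : IsLtClosed κ M :=
  fun a ha => hM a (ha.trans_le (ord_le_ord.2 h))

theorem IsLtClosed.inter {κ : Cardinal.{u}} {M M' : ZFSet.{u}} (h : IsLtClosed κ M)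
    (h' : IsLtClosed κ M') : IsLtClosed κ (M ∩ M') := by
  intro a ha f hf
  have (A : ZFSet.{u}) (hA : M ∩ M' ⊆ A) : ZFSet.IsFunc a.toZFSet A f := by
    refine ⟨fun z hz => ?_, hf.2⟩
    obtain ⟨x, hx, y, hy, rfl⟩ := ZFSet.mem_prod.1 (hf.1 hz)
    exact ZFSet.pair_mem_prod.2 ⟨hx, hA hy⟩
  exact ZFSet.mem_inter.2 ⟨h a ha f (this M fun x hx => (ZFSet.mem_inter.1 hx).1),
    h' a ha f (this M' fun x hx => (ZFSet.mem_inter.1 hx).2)⟩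

/-! ### Intersecting two families of models -/

section Families

variable {χ κ0 θ0 κ1 θ1 : Cardinal.{u}} {T L : OrdSys.{u}} {N0 N1 : ZFSet.{u} → ZFSet.{u}}

theorem IsModelFamily.le_card (h : IsModelFamily χ T κ0 θ0 N0) : κ0 ≤ θ0 := by
  obtain ⟨t, ht⟩ := h.index.nonempty
  exact h.card_eq t ht ▸ (h.elem t ht).le_card_of_isLtClosed (h.closed t ht)

/-- A model containing the sequence `⟨N t : t ∈ T⟩` and an index contains the value there. -/
theorem IsElemSubmodel.apply_mem_of_seqCode_mem {M : ZFSet.{u}} (hM : IsElemSubmodel χ M)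
    (hN : seqCode T N0 ∈ M) {t : ZFSet.{u}} (ht : t ∈ T.carrier) (htM : t ∈ M) : N0 t ∈ M := by
  refine hM.value_mem (hM.of_pair_mem hN).2 htM (ZFSet.mem_range.2 ⟨⟨t, ht⟩, rfl⟩) fun z hz => ?_
  obtain ⟨s, hs⟩ := ZFSet.mem_range.1 hz
  obtain ⟨rfl, rfl⟩ := ZFSet.pair_inj.1 hs
  rfl

/-- The chain `κ1 ≤ θ1 < κ0 ≤ θ0` does the work. It makes `N0 t` sufficiently closed, and it gives
both `θ1 ⊆ N0 t` and `θ1 ∈ N0 t` from `θ0 ⊆ N0 t`. -/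
theorem IsModelFamily.inter (h0 : IsModelFamily χ T κ0 θ0 N0) (h1 : IsModelFamily χ L κ1 θ1 N1)
    (hθκ : θ1 < κ0) (hmem : ∀ t ∈ T.carrier, ∀ a ∈ L.carrier, N0 t ∈ N1 a) :
    IsModelFamily χ (T.prod L) κ1 θ1 (interSeq N0 N1) := by
  have hθ : θ1 < θ0 := hθκ.trans_le h0.le_card
  have hsub : ∀ t ∈ T.carrier, ∀ a ∈ L.carrier, θ1.ord.toZFSet ⊆ N0 t ∩ N1 a := by
    intro t ht a ha x hx
    exact ZFSet.mem_inter.2 ⟨h0.theta_subset t ht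
      (Ordinal.toZFSet_monotone (ord_le_ord.2 hθ.le) hx), h1.theta_subset a ha hx⟩
  refine ⟨h1.regular, h1.uncountable, h1.infinite, h0.index.prod h1.index, ?_, ?_, ?_, ?_, ?_, ?_⟩
  · intro p hp
    obtain ⟨t, ht, a, ha, rfl⟩ := OrdSys.mem_carrier_prod.1 hp
    rw [interSeq_pair]
    exact (h0.elem t ht).inter (h1.elem a ha) (hmem t ht a ha)
  · intro p hp
    obtain ⟨t, ht, a, ha, rfl⟩ := OrdSys.mem_carrier_prod.1 hp
    rw [interSeq_pair]
    exact ((h0.closed t ht).mono (h1.le_card.trans hθκ.le)).inter (h1.closed a ha)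
  · intro p hp
    obtain ⟨t, ht, a, ha, rfl⟩ := OrdSys.mem_carrier_prod.1 hp
    rw [interSeq_pair]
    refine le_antisymm ?_ ?_
    · rw [← h1.card_eq a ha]
      exact ZFSet.card_mono fun x hx => (ZFSet.mem_inter.1 hx).2
    · simpa using ZFSet.card_mono (hsub t ht a ha)
  · intro p hp q hq hpq
    obtain ⟨t, ht, a, ha, rfl⟩ := OrdSys.mem_carrier_prod.1 hp
    obtain ⟨s, hs, b, hb, rfl⟩ := OrdSys.mem_carrier_prod.1 hq
    rw [OrdSys.prod_le_pair ht ha hs hb] at hpq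
    rw [interSeq_pair, interSeq_pair]
    intro x hx
    rw [ZFSet.mem_inter] at hx ⊢
    exact ⟨h0.mono t ht s hs hpq.1 hx.1, h1.mono a ha b hb hpq.2 hx.2⟩
  · intro p hp
    obtain ⟨t, ht, a, ha, rfl⟩ := OrdSys.mem_carrier_prod.1 hp
    rw [interSeq_pair]
    exact hsub t ht a ha
  · intro p hp
    obtain ⟨t, ht, a, ha, rfl⟩ := OrdSys.mem_carrier_prod.1 hp
    rw [interSeq_pair, ZFSet.mem_inter]
    exact ⟨h0.theta_subset t ht (Ordinal.toZFSet_mem_toZFSet_iff.2 (ord_lt_ord.2 hθ)),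
      h1.theta_mem a ha⟩

theorem IsElemSubmodel.of_code_mem {M : ZFSet.{u}} (hM : IsElemSubmodel χ M) {K : RelSys.{u}}
    (hK : K.code ∈ M) : K.X ∈ M ∧ K.Y ∈ M ∧ K.r ∈ M :=
  ⟨(hM.of_pair_mem hK).1, hM.of_pair_mem (hM.of_pair_mem hK).2⟩

theorem IsElemSubmodel.exists_bound {M : ZFSet.{u}} (hM : IsElemSubmodel χ M) {K : RelSys.{u}}
    (hK : K.code ∈ M) {F : ZFSet.{u}} (hF : F ∈ M) (hb : K.Bounded F) :
    ∃ y ∈ M, y ∈ K.Y ∧ ∀ x ∈ F, K.Rel x y := by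
  obtain ⟨-, hY, hr⟩ := hM.of_code_mem hK
  obtain ⟨y, hy, hyF⟩ := hb
  obtain ⟨z, hz, hzY, hzF⟩ := hM.exists_mem
    (P := fun y => y ∈ K.Y ∧ ∀ x : Hset χ, (x : ZFSet.{u}) ∈ F → ZFSet.pair x y ∈ K.r)
    (.and (.mem (.var _) (hM.const hY)) (.all (.imp (.mem (.var _) (hM.const hF))
      (.pair_mem (.var _) (.var _) (hM.const hr)))))
    ⟨y, mem_Hset_of_mem (hM.mem_Hset hY) hy, hy, fun x hx => hyF x hx⟩
  exact ⟨z, hz, hzY, fun x hx => hzF ⟨x, mem_Hset_of_mem (hM.mem_Hset hF) hx⟩ hx⟩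

/-- The trace of `K.X` on a member of the intersected family is bounded inside the union. -/
theorem exists_bound_inter (h0 : IsModelFamily χ T κ0 θ0 N0) (h1 : IsModelFamily χ L κ1 θ1 N1)
    (hθκ : θ1 < κ0) (hmem : ∀ t ∈ T.carrier, ∀ a ∈ L.carrier, N0 t ∈ N1 a)
    (hN1 : ∀ a ∈ L.carrier, N1 a ∈ seqUnion L N1) {K : RelSys.{u}}
    (hK0 : K.code ∈ seqUnion T N0) (hK1 : ∀ a ∈ L.carrier, K.code ∈ N1 a)
    (hb : (θ1 : WithTop Cardinal.{u}) < K.bnum) {t a : ZFSet.{u}} (ht : t ∈ T.carrier)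
    (ha : a ∈ L.carrier) :
    ∃ y ∈ seqUnion T N0 ∩ seqUnion L N1, y ∈ K.Y ∧ ∀ x ∈ K.X ∩ (N0 t ∩ N1 a), K.Rel x y := by
  obtain ⟨t₀, ht₀, hKt₀⟩ := mem_seqUnion.1 hK0
  -- `K` need not belong to `N0 t`, so `t` is enlarged to an index whose model contains it.
  obtain ⟨s, hs, hts, hts₀⟩ := h0.index.directed t ht t₀ ht₀
  have hKs := h0.mono t₀ ht₀ s hs hts₀ hKt₀
  -- The index `b₀` is chosen with `N1 a ∈ N1 b₀`; no comparison of `b₀` with `a` is needed.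
  obtain ⟨b₀, hb₀, hab₀⟩ := mem_seqUnion.1 (hN1 a ha)
  have hMs := h0.elem s hs
  have hMb := h1.elem b₀ hb₀
  let F := K.X ∩ (N0 s ∩ N1 a)
  have hFb : F ∈ N1 b₀ := hMb.inter_mem (hMb.of_code_mem (hK1 b₀ hb₀)).1
    (hMb.inter_mem (hmem s hs b₀ hb₀) hab₀)
  have hFc : F.card ≤ θ1 := by
    rw [← h1.card_eq a ha]
    exact ZFSet.card_mono fun x hx => (ZFSet.mem_inter.1 (ZFSet.mem_inter.1 hx).2).2
  -- Here `θ1 < κ0` is essential: `F` is a subset of `N0 s` small enough for its closure.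
  have hFs : F ∈ N0 s := hMs.mem_of_subset_of_card_lt (h0.closed s hs)
    (fun x hx => (ZFSet.mem_inter.1 (ZFSet.mem_inter.1 hx).2).1) (hFc.trans_lt hθκ)
  have hbd : K.Bounded F := RelSys.bounded_of_card_lt (fun x hx => (ZFSet.mem_inter.1 hx).1)
    ((WithTop.coe_le_coe.2 hFc).trans_lt hb)
  obtain ⟨y, hy, hyY, hyF⟩ := (hMs.inter hMb (hmem s hs b₀ hb₀)).exists_bound
    (ZFSet.mem_inter.2 ⟨hKs, hK1 b₀ hb₀⟩) (ZFSet.mem_inter.2 ⟨hFs, hFb⟩) hbd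
  rw [ZFSet.mem_inter] at hy
  refine ⟨y, ZFSet.mem_inter.2 ⟨mem_seqUnion.2 ⟨s, hs, hy.1⟩, mem_seqUnion.2 ⟨b₀, hb₀, hy.2⟩⟩, hyY,
    fun x hx => hyF x ?_⟩
  rw [ZFSet.mem_inter, ZFSet.mem_inter] at hx ⊢
  exact ⟨hx.1, h0.mono t ht s hs hts hx.2.1, hx.2.2⟩

theorem isProper_restrict (h0 : IsModelFamily χ T κ0 θ0 N0) (h1 : IsModelFamily χ L κ1 θ1 N1)
    (hmem : ∀ t ∈ T.carrier, ∀ a ∈ L.carrier, N0 t ∈ N1 a) {K : RelSys.{u}} (hK : K.IsProper)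
    (hK0 : K.code ∈ seqUnion T N0) (hK1 : ∀ a ∈ L.carrier, K.code ∈ N1 a) :
    (K.restrict (seqUnion T N0 ∩ seqUnion L N1)).IsProper := by
  obtain ⟨t, ht, hKt⟩ := mem_seqUnion.1 hK0
  obtain ⟨a, ha⟩ := h1.index.nonempty
  have hM := (h0.elem t ht).inter (h1.elem a ha) (hmem t ht a ha)
  have hN {x : ZFSet.{u}} (hx : x ∈ N0 t ∩ N1 a) : x ∈ seqUnion T N0 ∩ seqUnion L N1 := by
    rw [ZFSet.mem_inter] at hx ⊢
    exact ⟨mem_seqUnion.2 ⟨t, ht, hx.1⟩, mem_seqUnion.2 ⟨a, ha, hx.2⟩⟩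
  obtain ⟨hX, hY, -⟩ := hM.of_code_mem (ZFSet.mem_inter.2 ⟨hKt, hK1 a ha⟩)
  obtain ⟨x, hx, hxX⟩ := hM.exists_mem_of_nonempty hX hK.1
  obtain ⟨y, hy, hyY⟩ := hM.exists_mem_of_nonempty hY hK.2
  exact ⟨⟨x, ZFSet.mem_inter.2 ⟨hxX, hN hx⟩⟩, ⟨y, ZFSet.mem_inter.2 ⟨hyY, hN hy⟩⟩⟩

/-- One map sends a point to an index of a model containing it, the other sends an index to a bound
for its model. Monotonicity of the family makes this a Tukey connection. -/
theorem restrict_tukeyLE (hP : IsModelFamily χ T κ0 θ0 N0) {K : RelSys.{u}}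
    (hb : ∀ t ∈ T.carrier, ∃ y ∈ seqUnion T N0, y ∈ K.Y ∧ ∀ x ∈ K.X ∩ N0 t, K.Rel x y) :
    (K.restrict (seqUnion T N0)).TukeyLE T.toRelSys := by
  have hf (x : ZFSet.{u}) : ∃ t, x ∈ seqUnion T N0 → t ∈ T.carrier ∧ x ∈ N0 t := by
    by_cases hx : x ∈ seqUnion T N0
    · obtain ⟨t, ht⟩ := mem_seqUnion.1 hx
      exact ⟨t, fun _ => ht⟩
    · exact ⟨∅, fun h => absurd h hx⟩
  have hg (t : ZFSet.{u}) : ∃ y, t ∈ T.carrier →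
      y ∈ K.Y ∩ seqUnion T N0 ∧ ∀ x ∈ K.X ∩ N0 t, K.Rel x y := by
    by_cases ht : t ∈ T.carrier
    · obtain ⟨y, hy, hyY, h⟩ := hb t ht
      exact ⟨y, fun _ => ⟨ZFSet.mem_inter.2 ⟨hyY, hy⟩, h⟩⟩
    · exact ⟨∅, fun h => absurd h ht⟩
  choose f hf using hf
  choose g hg using hg
  refine ⟨f, g, fun x hx => (hf x (ZFSet.mem_inter.1 hx).2).1, fun t ht => (hg t ht).1, ?_⟩
  intro x hx t ht hxt
  obtain ⟨hxX, hxN⟩ := ZFSet.mem_inter.1 hx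
  obtain ⟨h1, h2⟩ := hf x hxN
  exact (hg t ht).2 x (ZFSet.mem_inter.2 ⟨hxX, hP.mono _ h1 t ht hxt h2⟩)

end Families

theorem mainTheorem3 (χ : Cardinal.{u}) (hχ : χ.IsRegular)
    (T : OrdSys.{u}) (lam : Ordinal.{u}) (hlam : Order.IsSuccLimit lam)
    (κ0 θ0 κ1 θ1 : Cardinal.{u}) (N0 N1 : ZFSet.{u} → ZFSet.{u})
    (h0 : IsDirectedSystem χ T κ0 θ0 N0)
    (h1 : IsDirectedSystem χ (OrdSys.ofOrdinal lam) κ1 θ1 N1)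
    (hN0 : seqCode T N0 ∈ N1 ∅) (hθκ : θ1 < κ0)
    (hN1 : ∀ α ∈ lam.toZFSet, N1 α ∈ seqUnion (OrdSys.ofOrdinal lam) N1)
    (hT : T.carrier ⊆ N1 ∅) :
    -- the inequalities that the assumptions imply
    (κ1 ≤ θ1 ∧ κ0 ≤ θ0 ∧ T.carrier.card ≤ θ1) ∧
    -- (a)
    IsModelFamily χ (T.prod (OrdSys.ofOrdinal lam)) κ1 θ1 (interSeq N0 N1) ∧
    ((∀ t ∈ T.carrier, lam.toZFSet ∈ N0 t) →
      IsDirectedSystem χ (T.prod (OrdSys.ofOrdinal lam)) κ1 θ1 (interSeq N0 N1)) ∧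
    seqUnion (T.prod (OrdSys.ofOrdinal lam)) (interSeq N0 N1) =
      seqUnion T N0 ∩ seqUnion (OrdSys.ofOrdinal lam) N1 ∧
    -- (b)
    ∀ K : RelSys.{u}, K.IsProper → K.code ∈ seqUnion T N0 → K.code ∈ N1 ∅ →
      (θ1 : WithTop Cardinal.{u}) < K.bnum →
      let KN := K.restrict (seqUnion (T.prod (OrdSys.ofOrdinal lam)) (interSeq N0 N1))
      KN.IsProper ∧
      KN.TukeyLE (T.prod (OrdSys.ofOrdinal lam)).toRelSys ∧
      min T.toRelSys.bnum (lam.cof : WithTop Cardinal.{u}) ≤ KN.bnum ∧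
      KN.dnum ≤ max T.toRelSys.dnum (lam.cof : WithTop Cardinal.{u}) := by
  -- The empty set is the ordinal `0`, the least index of the second system.
  have h0c : ∅ ∈ (OrdSys.ofOrdinal lam).carrier := by
    rw [← Ordinal.toZFSet_zero]
    exact Ordinal.toZFSet_mem_toZFSet_iff.2 hlam.bot_lt
  have hsub : ∀ a ∈ (OrdSys.ofOrdinal lam).carrier, N1 ∅ ⊆ N1 a := fun a ha =>
    h1.mono ∅ h0c a ha (OrdSys.ofOrdinal_le_iff.2 ⟨h0c, ha, ZFSet.empty_subset a⟩)
  have hmem : ∀ t ∈ T.carrier, ∀ a ∈ (OrdSys.ofOrdinal lam).carrier, N0 t ∈ N1 a :=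
    fun t ht a ha => hsub a ha ((h1.elem ∅ h0c).apply_mem_of_seqCode_mem hN0 ht (hT ht))
  have hfam := h0.toIsModelFamily.inter h1.toIsModelFamily hθκ hmem
  have hunion := seqUnion_interSeq T (OrdSys.ofOrdinal lam) N0 N1
  refine ⟨⟨h1.le_card, h0.le_card, ?_⟩, hfam, fun hl => ⟨hfam, fun p hp => ?_⟩, hunion, ?_⟩
  · exact h1.card_eq ∅ h0c ▸ ZFSet.card_mono hT
  · refine (hfam.elem p hp).code_prod_mem hχ ?_ ((hfam.elem p hp).code_ofOrdinal_mem hχ ?_)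
    all_goals
      obtain ⟨t, ht, a, ha, rfl⟩ := OrdSys.mem_carrier_prod.1 hp
      rw [interSeq_pair, ZFSet.mem_inter]
    -- `T` reaches the second models as the first component of `seqCode T N0`, which records the
    -- index order along with the sequence.
    · exact ⟨h0.index_mem t ht, hsub a ha ((h1.elem ∅ h0c).of_pair_mem hN0).1⟩
    · exact ⟨hl t ht, ((h1.elem a ha).of_pair_mem (h1.index_mem a ha)).1⟩
  · intro K hK hK0 hK1 hb KN
    have hK1' : ∀ a ∈ (OrdSys.ofOrdinal lam).carrier, K.code ∈ N1 a :=
      fun a ha => hsub a ha hK1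
    have htukey : KN.TukeyLE (T.prod (OrdSys.ofOrdinal lam)).toRelSys := by
      refine restrict_tukeyLE hfam fun p hp => ?_
      obtain ⟨t, ht, a, ha, rfl⟩ := OrdSys.mem_carrier_prod.1 hp
      rw [interSeq_pair, hunion]
      exact exists_bound_inter h0.toIsModelFamily h1.toIsModelFamily hθκ hmem hN1 hK0 hK1' hb ht ha
    refine ⟨?_, htukey, ?_, ?_⟩
    · have := isProper_restrict h0.toIsModelFamily h1.toIsModelFamily hmem hK hK0 hK1'
      rwa [← hunion] at this
    · exact ((min_le_min_left _ OrdSys.cof_le_bnum_ofOrdinal).trans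
        OrdSys.min_bnum_le_bnum_prod).trans htukey.bnum_le
    · exact htukey.dnum_le.trans
        -- A limit ordinal has infinite cofinality, as the product estimate requires.
        (OrdSys.dnum_prod_le (Ordinal.aleph0_le_cof_iff.2 (Ordinal.one_lt_cof_iff.2 hlam)) OrdSys.dnum_ofOrdinal_le)
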